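/- Let $\mathcal H$ be a complex Hilbert space of finite or countably infinite dimension, and write $\mathcal L(\mathcal H)$ for the bounded operators on $\mathcal H$. An observable on $\mathcal H$ is a family $(A(x))_{x\in\mathbb N}$, $\mathbb N=\{1,2,\dots\}$, of positive operators in $\mathcal L(\mathcal H)$ with $\sum_x A(x)=\mathbb 1_{\mathcal H}$. An observable $A$ is a post-processing (smearing) of an observable $B$, written $A\preceq B$, if there are real numbers $M_{xy}\ge 0$ ($x,y\in\mathbb N$) with $\sum_x M_{xy}=1$ for all $y$ and $A(x)=\sum_y M_{xy}B(y)$ for all $x$. A channel (in the Heisenberg picture) with output Hilbert space $\mathcal K$ is a normal completely positive linear map $\Lambda:\mathcal L(\mathcal K)\to\mathcal L(\mathcal H)$ with $\Lambda(\mathbb 1_{\mathcal K})=\mathbb 1_{\mathcal H}$. Such a $\Lambda$ is called an $A$-channel if there are normal completely positive linear maps $\mathcal I_x:\mathcal L(\mathcal K)\to\mathcal L(\mathcal H)$, $x\in\mathbb N$, with $\mathcal I_x(\mathbb 1_{\mathcal K})=A(x)$ for all $x$ and $\sum_x\mathcal I_x(C)=\Lambda(C)$ for all $C\in\mathcal L(\mathcal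 K)$. Let $\mathfrak C_A$ be the set of all $A$-channels, with arbitrary output Hilbert spaces $\mathcal K$. Infinite sums of operators converge in the weak operator topology. Theorem. Let $A$ and $B$ be observables on $\mathcal H$. Then $A\preceq B$ if and only if $\mathfrak C_B\subseteq\mathfrak C_A$. In particular, if $\mathfrak C_A=\mathfrak C_B$, then $A\preceq B$ and $B\preceq A$. -/

import Mathlib

open scoped CStarAlgebra InnerProductSpace

universe u

namespace NoiseDisturbance

/-- The (unordered) operator series `∑ i, T i` converges to `S` in the weak operator topology. -/
def WeakHasSum {ι : Type*} {H : Type*} [NormedAddCommGroup H] [InnerProductSpace ℂ H]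
    (T : ι → H →L[ℂ] H) (S : H →L[ℂ] H) : Prop :=
  ∀ φ ψ : H, HasSum (fun i => ⟪φ, T i ψ⟫_ℂ) ⟪φ, S ψ⟫_ℂ

/-- An observable on `H` with outcomes `1, 2, …`: positive operators that sum up to the identity.
(Some of the operators may be zero, so finite outcome sets are included.) -/
structure Observable (H : Type*) [NormedAddCommGroup H] [InnerProductSpace ℂ H]
    [CompleteSpace H] where
  /-- The operator that belongs to an outcome. -/
  effect : ℕ+ → H →L[ℂ] H
  nonneg : ∀ x, 0 ≤ effect x
  sum_eq_one : WeakHasSum effect 1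

/-- A stochastic matrix: nonnegative real entries, each column `y` sums up to one. -/
structure IsStochastic (M : ℕ+ → ℕ+ → ℝ) : Prop where
  nonneg : ∀ x y, 0 ≤ M x y
  sum_eq_one : ∀ y, HasSum (fun x => M x y) 1

section

variable {H : Type u} [NormedAddCommGroup H] [InnerProductSpace ℂ H] [CompleteSpace H]

/-- `A` is a post-processing (smearing) of `B`: `A(x) = ∑ y, M x y • B(y)` for some stochastic
matrix `M`. -/
def IsPostProcessing (A B : Observable H) : Prop :=
  ∃ M : ℕ+ → ℕ+ → ℝ, IsStochastic M ∧
    ∀ x, WeakHasSum (fun y => (M x y : ℂ) • B.effect y) (A.effect x)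

/-- `A` and `B` are post-processing equivalent. -/
def PostProcessingEquiv (A B : Observable H) : Prop :=
  IsPostProcessing A B ∧ IsPostProcessing B A

/-- A completely positive map is normal if it preserves suprema of increasing nets
(of directed sets) of operators, for the Loewner order. -/
def IsNormalMap {K : Type*} [NormedAddCommGroup K] [InnerProductSpace ℂ K] [CompleteSpace K]
    (Φ : (K →L[ℂ] K) →CP (H →L[ℂ] H)) : Prop :=
  ScottContinuous Φ

end

/-- A channel in the Heisenberg picture, with output space `K` and input space `H`: a normal unital
completely positive map from the bounded operators on `K` to those on `H`. -/
structure Channel (K H : Type*) [NormedAddCommGroup K] [InnerProductSpace ℂ K] [CompleteSpace K]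
    [NormedAddCommGroup H] [InnerProductSpace ℂ H] [CompleteSpace H] where
  /-- The underlying completely positive map. -/
  toCP : (K →L[ℂ] K) →CP (H →L[ℂ] H)
  normal : IsNormalMap toCP
  map_one : toCP 1 = 1

/-- An instrument in the Heisenberg picture: a sequence of normal completely positive maps
whose sum is a channel. -/
structure Instrument (K H : Type*) [NormedAddCommGroup K] [InnerProductSpace ℂ K] [CompleteSpace K]
    [NormedAddCommGroup H] [InnerProductSpace ℂ H] [CompleteSpace H] where
  /-- The completely positive map that belongs to an outcome. -/
  op : ℕ+ → (K →L[ℂ] K) →CP (H →L[ℂ] H)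
  normal : ∀ x, IsNormalMap (op x)
  /-- The sum of the operations. -/
  total : Channel K H
  sum_eq_total : ∀ C, WeakHasSum (fun x => op x C) (total.toCP C)

section

variable {H : Type u} [NormedAddCommGroup H] [InnerProductSpace ℂ H] [CompleteSpace H]

/-- The channel `Λ` is an `A`-channel: `A` and `Λ` are parts of a single instrument. -/
def IsCompatible {K : Type*} [NormedAddCommGroup K] [InnerProductSpace ℂ K] [CompleteSpace K]
    (A : Observable H) (Λ : Channel K H) : Prop :=
  ∃ J : Instrument K H, (∀ x, J.op x 1 = A.effect x) ∧
    ∀ C, WeakHasSum (fun x => J.op x C) (Λ.toCP C)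

variable (H) in
/-- The channels from an arbitrary output Hilbert space to the fixed input space `H`. -/
structure AnyChannel where
  /-- The output Hilbert space. -/
  Out : Type u
  [normedAddCommGroup : NormedAddCommGroup Out]
  [innerProductSpace : InnerProductSpace ℂ Out]
  [completeSpace : CompleteSpace Out]
  /-- The channel itself. -/
  channel : Channel Out H

attribute [instance] AnyChannel.normedAddCommGroup AnyChannel.innerProductSpace
  AnyChannel.completeSpace

/-- The set of all `A`-channels, with arbitrary output spaces. -/
def channelsOf (A : Observable H) : Set (AnyChannel H) :=
  {Λ | IsCompatible A Λ.channel}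

end

end NoiseDisturbance

open scoped ComplexOrder
open Filter Topology

/-! If `A` smears `B` through `M`, and the maps J_y form an instrument for `B` with total Λ, then
the maps ∑_y M_xy J_y form one for `A` with the same total (`IsCompatible.of_isPostProcessing`).

Conversely, a single channel decides: Λ(C) = ∑_y V_y⋆ C V_y, where V_y⋆ V_y = B(y) and the V_y map
into mutually orthogonal blocks with projections P_y. Suppose Λ = ∑_x I_x with I_x(1) = A(x). In the
Stinespring space of Λ, P_y ⊗ φ and R ⊗ ψ are the same vector when R is the rank one operator that
carries V_y ψ to V_y φ and kills V_z ψ for z ≠ y. The form of I_x is dominated by that of Λ, so it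
identifies them too. This makes I_x(P_y) a multiple of B(y) (`exists_weights`), and summation over y
gives the smearing (`isPostProcessing`). -/

/-! ### Positivity of operator matrices through quadratic forms. -/

lemma CStarAlgebra.exists_nonneg_sub_of_isSelfAdjoint {A : Type*} [NonUnitalCStarAlgebra A]
    [PartialOrder A] [StarOrderedRing A] {a : A} (ha : IsSelfAdjoint a) :
    ∃ p q : A, 0 ≤ p ∧ 0 ≤ q ∧ a = p - q ∧ q * p = 0 :=
  ⟨a⁺, a⁻, CFC.posPart_nonneg a, CFC.negPart_nonneg a, (CFC.posPart_sub_negPart a ha).symm,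
    CFC.negPart_mul_posPart a⟩

lemma CStarAlgebra.exists_eq_star_mul_self_of_nonneg {A : Type*} [NonUnitalCStarAlgebra A]
    [PartialOrder A] [StarOrderedRing A] {a : A} (ha : 0 ≤ a) : ∃ b : A, a = star b * b :=
  CStarAlgebra.nonneg_iff_eq_star_mul_self.1 ha

lemma CStarAlgebra.eq_zero_of_mul_self_mul_self {A : Type*} [NonUnitalCStarAlgebra A] {a : A}
    (ha : IsSelfAdjoint a) (h : a * a * a = 0) : a = 0 := by
  have h4 : star (a * a) * (a * a) = 0 := by
    rw [star_mul, ha.star_eq, ← mul_assoc, h, zero_mul]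
  rw [CStarRing.star_mul_self_eq_zero_iff] at h4
  rw [← CStarRing.star_mul_self_eq_zero_iff, ha.star_eq, h4]

namespace CStarMatrix

variable {n H : Type*} [Fintype n] [NormedAddCommGroup H] [InnerProductSpace ℂ H]

/-- The quadratic form of a matrix of operators. -/
noncomputable def quadForm (M : CStarMatrix n n (H →L[ℂ] H)) (v : n → H) : ℂ :=
  ∑ i, ∑ j, ⟪v i, M i j (v j)⟫_ℂ

lemma quadForm_neg (M : CStarMatrix n n (H →L[ℂ] H)) (v : n → H) :
    quadForm (-M) v = -quadForm M v := by
  simp [quadForm]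

lemma quadForm_sub (M N : CStarMatrix n n (H →L[ℂ] H)) (v : n → H) :
    quadForm (M - N) v = quadForm M v - quadForm N v := by
  simp [quadForm]

/-- A matrix of operators, as a linear map on the direct sum of copies of the space. -/
noncomputable def toDirectSum (M : CStarMatrix n n (H →L[ℂ] H)) :
    PiLp 2 (fun _ : n => H) →ₗ[ℂ] PiLp 2 (fun _ : n => H) where
  toFun v := WithLp.toLp 2 fun i => ∑ j, M i j (v j)
  map_add' v w := by ext i; simp [Finset.sum_add_distrib]
  map_smul' c v := by ext i; simp [Finset.smul_sum]

/-- Over ℂ, polarization recovers an operator on the direct sum from its diagonal form. -/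
lemma eq_zero_of_quadForm_eq_zero [DecidableEq n] {M : CStarMatrix n n (H →L[ℂ] H)}
    (h : ∀ v, quadForm M v = 0) : M = 0 := by
  have hT : toDirectSum M = 0 := by
    rw [← inner_map_self_eq_zero]
    intro v
    rw [← inner_conj_symm, map_eq_zero, PiLp.inner_apply]
    simpa [toDirectSum, quadForm, inner_sum] using h v
  ext i j x
  have := congrArg (fun T => T (PiLp.single 2 j x) i) hT
  simpa [toDirectSum, Pi.single_apply, apply_ite] using this

variable [CompleteSpace H]

lemma quadForm_star_mul_mul (M N : CStarMatrix n n (H →L[ℂ] H)) (v : n → H) :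
    quadForm (star N * M * N) v = quadForm M fun i => ∑ j, N i j (v j) := by
  simp only [quadForm, mul_apply, star_apply, sum_apply,
    mul_apply_eq_comp, ContinuousLinearMap.star_eq_adjoint, Finset.sum_mul, inner_sum,
    sum_inner, map_sum, ContinuousLinearMap.adjoint_inner_right]
  simp_rw [← Fintype.sum_prod_type']
  exact Fintype.sum_equiv ⟨fun p => ⟨p.2.2.2, p.2.2.1, p.2.1, p.1⟩,
    fun p => ⟨p.2.2.2, p.2.2.1, p.2.1, p.1⟩, fun _ => rfl, fun _ => rfl⟩ _ _ fun _ => rfl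

lemma quadForm_star_mul_self_nonneg (N : CStarMatrix n n (H →L[ℂ] H)) (v : n → H) :
    0 ≤ quadForm (star N * N) v := by
  classical
  have h := quadForm_star_mul_mul 1 N v
  rw [mul_one] at h
  rw [h, quadForm]
  refine Finset.sum_nonneg fun i _ => ?_
  rw [Finset.sum_eq_single i]
  · simp
  · intro j _ hj
    simp [one_apply_ne hj.symm]
  · simp

lemma quadForm_star (M : CStarMatrix n n (H →L[ℂ] H)) (v : n → H) :
    quadForm (star M) v = star (quadForm M v) := by
  simp only [quadForm, star_sum, star_apply, ContinuousLinearMap.star_eq_adjoint,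
    ContinuousLinearMap.adjoint_inner_right]
  rw [Finset.sum_comm]
  simp

/-- A matrix of operators is nonnegative if and only if its quadratic form is. -/
theorem nonneg_iff_quadForm_nonneg {M : CStarMatrix n n (H →L[ℂ] H)} :
    0 ≤ M ↔ ∀ v, 0 ≤ quadForm M v := by
  classical
  have hpos : ∀ M : CStarMatrix n n (H →L[ℂ] H), 0 ≤ M → ∀ v, 0 ≤ quadForm M v := by
    intro M hM v
    obtain ⟨N, rfl⟩ := CStarAlgebra.exists_eq_star_mul_self_of_nonneg hM
    exact quadForm_star_mul_self_nonneg N v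
  refine ⟨hpos M, fun h => ?_⟩
  have hsa : IsSelfAdjoint M := by
    rw [IsSelfAdjoint, ← sub_eq_zero]
    refine eq_zero_of_quadForm_eq_zero fun v => ?_
    rw [quadForm_sub, quadForm_star, sub_eq_zero]
    exact (IsSelfAdjoint.of_nonneg (h v))
  -- With M = P - N and N P = 0, testing the form of M on vectors N v gives -N³ ≥ 0. Since N³ ≥ 0 as
  -- well, N³ = 0 and so N = 0.
  obtain ⟨P, N, hP, hN, rfl, hNP⟩ := CStarAlgebra.exists_nonneg_sub_of_isSelfAdjoint hsa
  have hn : star N = N := IsSelfAdjoint.of_nonneg hN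
  have h1 : star N * (P - N) * N = -(star N * N * N) := by
    rw [hn, mul_sub, hNP, zero_sub, neg_mul]
  have h3 : star N * N * N = 0 := by
    refine eq_zero_of_quadForm_eq_zero fun v => le_antisymm ?_ ?_
    · have := h fun i => ∑ j, N i j (v j)
      rwa [← quadForm_star_mul_mul, h1, quadForm_neg, Left.nonneg_neg_iff] at this
    · rw [quadForm_star_mul_mul]
      exact hpos _ hN _
  have h2 : N = 0 := by
    rw [hn] at h3
    exact CStarAlgebra.eq_zero_of_mul_self_mul_self hn h3
  rwa [h2, sub_zero]

end CStarMatrix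

namespace NoiseDisturbance

/-! ### Weak operator sums and monotone limits. -/

section

variable {ι H : Type*} [NormedAddCommGroup H] [InnerProductSpace ℂ H]

lemma WeakHasSum.unique {T : ι → H →L[ℂ] H} {S S' : H →L[ℂ] H} (h : WeakHasSum T S)
    (h' : WeakHasSum T S') : S = S' := by
  ext ψ
  exact ext_inner_left ℂ fun φ => (h φ ψ).unique (h' φ ψ)

lemma inner_map_polarization (R : H →L[ℂ] H) (φ ψ : H) : ⟪φ, R ψ⟫_ℂ =
    (⟪φ + ψ, R (φ + ψ)⟫_ℂ - ⟪φ - ψ, R (φ - ψ)⟫_ℂ -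
      Complex.I * ⟪φ + Complex.I • ψ, R (φ + Complex.I • ψ)⟫_ℂ +
      Complex.I * ⟪φ - Complex.I • ψ, R (φ - Complex.I • ψ)⟫_ℂ) / 4 := by
  simp only [map_add, map_sub, map_smul, inner_add_left, inner_add_right, inner_sub_left,
    inner_sub_right, inner_smul_left, inner_smul_right, Complex.conj_I]
  linear_combination ((⟪φ, R ψ⟫_ℂ - ⟪ψ, R φ⟫_ℂ) / 2) * Complex.I_mul_I

lemma weakHasSum_of_inner_self {T : ι → H →L[ℂ] H} {S : H →L[ℂ] H}
    (h : ∀ φ, HasSum (fun i => ⟪φ, T i φ⟫_ℂ) ⟪φ, S φ⟫_ℂ) : WeakHasSum T S := by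
  intro φ ψ
  simp_rw [inner_map_polarization _ φ ψ]
  exact ((((h _).sub (h _)).sub ((h _).mul_left _)).add ((h _).mul_left _)).div_const _

lemma nonneg_iff_inner_nonneg {T : H →L[ℂ] H} : 0 ≤ T ↔ ∀ φ, 0 ≤ ⟪φ, T φ⟫_ℂ := by
  rw [ContinuousLinearMap.nonneg_iff_isPositive]
  refine ⟨fun h => h.inner_nonneg_right, fun h => ?_⟩
  rw [ContinuousLinearMap.isPositive_iff_complex]
  intro φ
  have := h φ
  rw [← inner_conj_symm, Complex.nonneg_iff] at this
  simp only [Complex.conj_re, Complex.conj_im] at this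
  refine ⟨Complex.ext (by simp) (by rw [Complex.ofReal_im, eq_comm]; simpa using this.2), this.1⟩

lemma le_iff_inner_le_inner {T S : H →L[ℂ] H} : T ≤ S ↔ ∀ φ, ⟪φ, T φ⟫_ℂ ≤ ⟪φ, S φ⟫_ℂ := by
  rw [ContinuousLinearMap.le_def, ← ContinuousLinearMap.nonneg_iff_isPositive,
    nonneg_iff_inner_nonneg]
  simp

lemma WeakHasSum.le {T : ι → H →L[ℂ] H} {S : H →L[ℂ] H} (h : WeakHasSum T S)
    (hT : ∀ i, 0 ≤ T i) (i : ι) : T i ≤ S :=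
  le_iff_inner_le_inner.2 fun φ =>
    le_hasSum (h φ φ) i fun j _ => nonneg_iff_inner_nonneg.1 (hT j) φ

variable [CompleteSpace H]

/-- A pointwise bounded family of operators that converges in the weak operator topology has
a bounded operator as its limit. -/
lemma exists_inner_eq_of_tendsto {l : Filter ι} [l.NeBot] {T : ι → H →L[ℂ] H} {f : H → H → ℂ}
    (hb : ∀ φ ψ, ∃ C, ∀ i, ‖⟪φ, T i ψ⟫_ℂ‖ ≤ C)
    (ht : ∀ φ ψ, Tendsto (fun i => ⟪φ, T i ψ⟫_ℂ) l (𝓝 (f φ ψ))) :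
    ∃ S : H →L[ℂ] H, ∀ φ ψ, ⟪φ, S ψ⟫_ℂ = f φ ψ := by
  -- Uniform boundedness is applied twice: to the functionals of the vectors `T i ψ`, then to the
  -- operators.
  obtain ⟨C, hC⟩ : ∃ C, ∀ i, ‖T i‖ ≤ C := by
    refine banach_steinhaus fun ψ => ?_
    obtain ⟨C, hC⟩ := banach_steinhaus (g := fun i => innerSL ℂ (T i ψ)) fun φ => by
      obtain ⟨C, hC⟩ := hb φ ψ
      exact ⟨C, fun i => by simpa [norm_inner_symm] using hC i⟩
    exact ⟨C, fun i => by simpa using hC i⟩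
  have ht' : ∀ ψ φ, Tendsto (fun i => ⟪T i ψ, φ⟫_ℂ) l (𝓝 (starRingEnd ℂ (f φ ψ))) := by
    intro ψ φ
    simpa [Function.comp_def] using (Complex.continuous_conj.tendsto _).comp (ht φ ψ)
  let B : H →ₗ⋆[ℂ] H →ₗ[ℂ] ℂ := LinearMap.mk₂'ₛₗ (starRingEnd ℂ) (RingHom.id ℂ)
    (fun ψ φ => starRingEnd ℂ (f φ ψ))
    (fun ψ ψ' φ => tendsto_nhds_unique (ht' _ _)
      (by simpa [inner_add_left] using (ht' ψ φ).add (ht' ψ' φ)))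
    (fun c ψ φ => tendsto_nhds_unique (ht' _ _)
      (by simpa [inner_smul_left, mul_comm] using (ht' ψ φ).const_mul (starRingEnd ℂ c)))
    (fun ψ φ φ' => tendsto_nhds_unique (ht' _ _)
      (by simpa [inner_add_right] using (ht' ψ φ).add (ht' ψ φ')))
    (fun c ψ φ => tendsto_nhds_unique (ht' _ _)
      (by simpa [inner_smul_right] using (ht' ψ φ).const_mul c))
  let B' : H →L⋆[ℂ] H →L[ℂ] ℂ := B.mkContinuous₂ C fun ψ φ => by
    refine le_of_tendsto (ht' ψ φ).norm (Eventually.of_forall fun i => ?_)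
    refine (norm_inner_le_norm _ _).trans ?_
    gcongr
    exact (T i).le_of_opNorm_le (hC i) ψ
  refine ⟨InnerProductSpace.continuousLinearMapOfBilin B', fun φ ψ => ?_⟩
  rw [← inner_conj_symm, InnerProductSpace.continuousLinearMapOfBilin_apply]
  simp [B', B]

lemma exists_weakHasSum {T : ι → H →L[ℂ] H} (h : ∀ φ ψ, Summable fun i => ⟪φ, T i ψ⟫_ℂ) :
    ∃ S, WeakHasSum T S := by
  obtain ⟨S, hS⟩ := exists_inner_eq_of_tendsto (l := atTop) (T := fun F : Finset ι => ∑ i ∈ F, T i)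
    (f := fun φ ψ => ∑' i, ⟪φ, T i ψ⟫_ℂ)
    (fun φ ψ => ⟨∑' i, ‖⟪φ, T i ψ⟫_ℂ‖, fun F => by
      rw [sum_apply, inner_sum]
      exact (norm_sum_le _ _).trans ((h φ ψ).norm.sum_le_tsum F fun _ _ => norm_nonneg _)⟩)
    (fun φ ψ => by simpa [inner_sum, HasSum] using (h φ ψ).hasSum)
  refine ⟨S, fun φ ψ => ?_⟩
  rw [hS]
  exact (h φ ψ).hasSum

/-- Vigier's theorem: a directed set of operators, bounded below, converges weakly to its
supremum. -/
theorem tendsto_inner_of_isLUB {d : Set (H →L[ℂ] H)} {b a : H →L[ℂ] H} (hb : b ∈ d)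
    (hle : ∀ t ∈ d, b ≤ t) (hd : DirectedOn (· ≤ ·) d) (ha : IsLUB d a) (φ : H) :
    Tendsto (fun t : d => ⟪φ, t.1 φ⟫_ℂ) atTop (𝓝 ⟪φ, a φ⟫_ℂ) := by
  have : Nonempty d := ⟨⟨b, hb⟩⟩
  have : IsDirectedOrder d := ⟨fun s t => by
    obtain ⟨r, hr, h1, h2⟩ := hd s.1 s.2 t.1 t.2
    exact ⟨⟨r, hr⟩, h1, h2⟩⟩
  have hconv : ∀ φ, ∃ z, Tendsto (fun t : d => ⟪φ, t.1 φ⟫_ℂ) atTop (𝓝 z) := by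
    intro φ
    -- Since t - b ≥ 0, only the real part varies with t; it is monotone and bounded by that of `a`.
    have him : ∀ t : d, (⟪φ, t.1 φ⟫_ℂ).im = (⟪φ, b φ⟫_ℂ).im := fun t =>
      ((Complex.le_def.1 (le_iff_inner_le_inner.1 (hle t.1 t.2) φ)).2).symm
    have hre : Tendsto (fun t : d => (⟪φ, t.1 φ⟫_ℂ).re) atTop (𝓝 (⨆ t : d, (⟪φ, t.1 φ⟫_ℂ).re)) := by
      refine tendsto_atTop_ciSup
        (fun s t hst => (Complex.le_def.1 (le_iff_inner_le_inner.1 hst φ)).1) ⟨(⟪φ, a φ⟫_ℂ).re, ?_⟩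
      rintro _ ⟨t, rfl⟩
      exact (Complex.le_def.1 (le_iff_inner_le_inner.1 (ha.1 t.2) φ)).1
    refine ⟨((⨆ t : d, (⟪φ, t.1 φ⟫_ℂ).re : ℝ) : ℂ) + (⟪φ, b φ⟫_ℂ).im * Complex.I, ?_⟩
    refine (((Complex.continuous_ofReal.tendsto _).comp hre).add_const _).congr fun t => ?_
    rw [← him t]
    exact Complex.re_add_im _
  have hconv' : ∀ φ ψ, ∃ z, Tendsto (fun t : d => ⟪φ, t.1 ψ⟫_ℂ) atTop (𝓝 z) := by
    intro φ ψ
    obtain ⟨z₁, h₁⟩ := hconv (φ + ψ)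
    obtain ⟨z₂, h₂⟩ := hconv (φ - ψ)
    obtain ⟨z₃, h₃⟩ := hconv (φ + Complex.I • ψ)
    obtain ⟨z₄, h₄⟩ := hconv (φ - Complex.I • ψ)
    refine ⟨_, ((((h₁.sub h₂).sub (h₃.const_mul Complex.I)).add
      (h₄.const_mul Complex.I)).div_const 4).congr fun t => ?_⟩
    exact (inner_map_polarization _ φ ψ).symm
  choose f hf using hconv'
  obtain ⟨S, hS⟩ := exists_inner_eq_of_tendsto (fun φ ψ => ⟨‖φ‖ * ((‖a - b‖ + ‖b‖) * ‖ψ‖), fun t => by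
    refine (norm_inner_le_norm _ _).trans ?_
    gcongr
    refine t.1.le_of_opNorm_le ?_ ψ
    have : ‖t.1 - b‖ ≤ ‖a - b‖ := CStarAlgebra.norm_le_norm_of_nonneg_of_le
      (sub_nonneg.2 (hle t.1 t.2)) (sub_le_sub_right (ha.1 t.2) b)
    calc ‖t.1‖ = ‖(t.1 - b) + b‖ := by simp
      _ ≤ _ := (norm_add_le _ _).trans (by gcongr)⟩) hf
  have hSa : S = a := by
    refine le_antisymm (le_iff_inner_le_inner.2 fun φ => ?_) (ha.2 fun t ht =>
      le_iff_inner_le_inner.2 fun φ => ?_)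
    · rw [hS]
      exact le_of_tendsto' (hf φ φ) fun t => le_iff_inner_le_inner.1 (ha.1 t.2) φ
    · rw [hS]
      exact Monotone.ge_of_tendsto (f := fun t : d => ⟪φ, t.1 φ⟫_ℂ)
        (fun s t hst => le_iff_inner_le_inner.1 hst φ) (hf φ φ) ⟨t, ht⟩
  rw [← hSa, hS]
  exact hf φ φ

end

/-! ### Completely positive maps and normality. -/

section

variable {ι H K : Type*} [NormedAddCommGroup H] [InnerProductSpace ℂ H] [CompleteSpace H]
  [NormedAddCommGroup K] [InnerProductSpace ℂ K] [CompleteSpace K]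

lemma cp_nonneg (Φ : (K →L[ℂ] K) →CP (H →L[ℂ] H)) {C : K →L[ℂ] K} (hC : 0 ≤ C) : 0 ≤ Φ C := by
  simpa using OrderHomClass.mono Φ hC

/-- The positive form `∑ i j, ⟪v i, Φ (C i⋆ C j) (v j)⟫` of a completely positive map `Φ`. -/
noncomputable def cpForm {n : Type*} [Fintype n] (Φ : (K →L[ℂ] K) →CP (H →L[ℂ] H))
    (C : n → K →L[ℂ] K) (v : n → H) : ℂ :=
  ∑ i, ∑ j, ⟪v i, Φ (star (C i) * C j) (v j)⟫_ℂ

lemma sum_inner_star_mul {n : Type*} [Fintype n] (C : n → K →L[ℂ] K) (w : n → K) :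
    ∑ i, ∑ j, ⟪w i, (star (C i) * C j) (w j)⟫_ℂ = ⟪∑ i, C i (w i), ∑ i, C i (w i)⟫_ℂ := by
  rw [sum_inner]
  refine Finset.sum_congr rfl fun i _ => ?_
  rw [inner_sum]
  exact Finset.sum_congr rfl fun j _ =>
    ContinuousLinearMap.adjoint_inner_right (C i) (w i) (C j (w j))

/-- The Gram matrix with entries `star (C i) * C j` is nonnegative, because its quadratic form is a
squared norm. -/
lemma cpForm_nonneg (Φ : (K →L[ℂ] K) →CP (H →L[ℂ] H)) {n : Type*} [Fintype n]
    (C : n → K →L[ℂ] K) (v : n → H) : 0 ≤ cpForm Φ C v := by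
  have hM : 0 ≤ (CStarMatrix.ofMatrix (fun i j => star (C i) * C j) :
      CStarMatrix n n (K →L[ℂ] K)) := by
    refine CStarMatrix.nonneg_iff_quadForm_nonneg.2 fun w => ?_
    have h0 : 0 ≤ ⟪∑ i, C i (w i), ∑ i, C i (w i)⟫_ℂ := by simp
    exact h0.trans_eq (sum_inner_star_mul C w).symm
  exact CStarMatrix.nonneg_iff_quadForm_nonneg.1 (Φ.map_cstarMatrix_nonneg _ hM) v

lemma hasSum_cpForm {n : Type*} [Fintype n] {Φ : ι → (K →L[ℂ] K) →CP (H →L[ℂ] H)}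
    {Ψ : (K →L[ℂ] K) →CP (H →L[ℂ] H)} (h : ∀ C, WeakHasSum (fun i => Φ i C) (Ψ C))
    (C : n → K →L[ℂ] K) (v : n → H) : HasSum (fun i => cpForm (Φ i) C v) (cpForm Ψ C v) :=
  hasSum_sum fun i _ => hasSum_sum fun j _ => h (star (C i) * C j) (v i) (v j)

/-- A linear map between operator spaces that preserves nonnegativity of quadratic forms is
completely positive. -/
noncomputable def cpOfQuadForm (f : (K →L[ℂ] K) →ₗ[ℂ] (H →L[ℂ] H))
    (hf : ∀ (k : ℕ) (M : CStarMatrix (Fin k) (Fin k) (K →L[ℂ] K)), (∀ v, 0 ≤ M.quadForm v) →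
      ∀ v, 0 ≤ (M.map f).quadForm v) : (K →L[ℂ] K) →CP (H →L[ℂ] H) where
  toLinearMap := f
  map_cstarMatrix_nonneg' k M hM := CStarMatrix.nonneg_iff_quadForm_nonneg.2
    (hf k M (CStarMatrix.nonneg_iff_quadForm_nonneg.1 hM))

/-- A nonnegative multiple of a completely positive map. -/
noncomputable def cpSMul (c : ℝ) (hc : 0 ≤ c) (Φ : (K →L[ℂ] K) →CP (H →L[ℂ] H)) :
    (K →L[ℂ] K) →CP (H →L[ℂ] H) :=
  cpOfQuadForm ((c : ℂ) • Φ.toLinearMap) fun k M hM v => by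
    have h := mul_nonneg (Complex.zero_le_real.2 hc) (CStarMatrix.nonneg_iff_quadForm_nonneg.1
      (Φ.map_cstarMatrix_nonneg M (CStarMatrix.nonneg_iff_quadForm_nonneg.2 hM)) v)
    refine h.trans_eq ?_
    simp only [CStarMatrix.quadForm, Finset.mul_sum]
    refine Finset.sum_congr rfl fun i _ => Finset.sum_congr rfl fun j _ => ?_
    exact (inner_smul_right _ _ _).symm

lemma cpSMul_apply (c : ℝ) (hc : 0 ≤ c) (Φ : (K →L[ℂ] K) →CP (H →L[ℂ] H)) (C : K →L[ℂ] K) :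
    cpSMul c hc Φ C = (c : ℂ) • Φ C := rfl

/-- The sum of a weakly summable family of completely positive maps. -/
theorem exists_cp_weakHasSum {Φ : ι → (K →L[ℂ] K) →CP (H →L[ℂ] H)}
    (h : ∀ C φ ψ, Summable fun i => ⟪φ, Φ i C ψ⟫_ℂ) :
    ∃ Ψ : (K →L[ℂ] K) →CP (H →L[ℂ] H), ∀ C, WeakHasSum (fun i => Φ i C) (Ψ C) := by
  choose f hf using fun C => exists_weakHasSum (h C)
  let g : (K →L[ℂ] K) →ₗ[ℂ] (H →L[ℂ] H) :=
    { toFun := f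
      map_add' := fun C D => (hf (C + D)).unique fun φ ψ => by
        simpa [inner_add_right] using (hf C φ ψ).add (hf D φ ψ)
      map_smul' := fun c C => (hf (c • C)).unique fun φ ψ => by
        simpa [inner_smul_right] using (hf C φ ψ).mul_left c }
  refine ⟨cpOfQuadForm g fun k M hM v => ?_, hf⟩
  have hs : HasSum (fun y => (M.map (Φ y)).quadForm v) ((M.map g).quadForm v) :=
    hasSum_sum fun i _ => hasSum_sum fun j _ => hf (M i j) (v i) (v j)
  refine hs.nonneg fun y => ?_
  exact CStarMatrix.nonneg_iff_quadForm_nonneg.1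
    ((Φ y).map_cstarMatrix_nonneg M (CStarMatrix.nonneg_iff_quadForm_nonneg.2 hM)) v

/-- A completely positive map dominated by a normal map is normal. -/
theorem IsNormalMap.of_le {Φ Ψ : (K →L[ℂ] K) →CP (H →L[ℂ] H)} (hΦ : IsNormalMap Φ)
    (h : ∀ C, 0 ≤ C → Ψ C ≤ Φ C) : IsNormalMap Ψ := by
  intro d hne hd a ha
  refine ⟨?_, fun c hc => ?_⟩
  · rintro _ ⟨t, ht, rfl⟩
    exact OrderHomClass.mono Ψ (ha.1 ht)
  -- Φ - Ψ is monotone, so adding its value at `a` turns a bound for Ψ on `d` into one for Φ, where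
  -- normality applies.
  have key : Φ a ≤ c + (Φ a - Ψ a) := by
    refine (hΦ hne hd ha).2 ?_
    rintro _ ⟨t, ht, rfl⟩
    have h1 := h (a - t) (sub_nonneg.2 (ha.1 ht))
    rw [map_sub, map_sub] at h1
    have h2 : Ψ t ≤ c := hc ⟨t, ht, rfl⟩
    calc Φ t = Ψ t + (Φ a - Ψ a) + ((Ψ a - Ψ t) - (Φ a - Φ t)) := by abel
      _ ≤ c + (Φ a - Ψ a) + 0 := by
        gcongr
        exact sub_nonpos.2 h1
      _ = _ := add_zero _
  rw [add_sub_left_comm] at key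
  simpa using key

/-- The part of a directed set above one of its elements is cofinal, so it has the same supremum; it
also has the lower bound that Vigier's theorem requires. -/
lemma IsNormalMap.of_bddBelow {Φ : (K →L[ℂ] K) →CP (H →L[ℂ] H)}
    (h : ∀ (d : Set (K →L[ℂ] K)) (b a : K →L[ℂ] K) (c : H →L[ℂ] H), b ∈ d → (∀ t ∈ d, b ≤ t) →
      DirectedOn (· ≤ ·) d → IsLUB d a → (∀ t ∈ d, Φ t ≤ c) → Φ a ≤ c) : IsNormalMap Φ := by
  intro d hne hd a ha
  refine ⟨?_, fun c hc => ?_⟩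
  · rintro _ ⟨t, ht, rfl⟩
    exact OrderHomClass.mono Φ (ha.1 ht)
  obtain ⟨b, hb⟩ := hne
  refine h {t ∈ d | b ≤ t} b a c ⟨hb, le_rfl⟩ (fun t ht => ht.2) ?_ ⟨fun t ht => ha.1 ht.1, ?_⟩
    fun t ht => hc ⟨t, ht.1, rfl⟩
  · intro s hs t ht
    obtain ⟨r, hr, hsr, htr⟩ := hd s hs.1 t ht.1
    exact ⟨r, ⟨hr, hs.2.trans hsr⟩, hsr, htr⟩
  · intro e he
    refine ha.2 fun t ht => ?_
    obtain ⟨r, hr, hbr, htr⟩ := hd b hb t ht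
    exact htr.trans (he ⟨hr, hbr⟩)

/-- The completely positive map with a single Kraus operator. -/
noncomputable def krausMap (V : H →L[ℂ] K) : (K →L[ℂ] K) →CP (H →L[ℂ] H) :=
  cpOfQuadForm
    { toFun := fun C => V.adjoint ∘L C ∘L V
      map_add' := fun C D => by ext; simp
      map_smul' := fun c C => by ext; simp }
    fun k M hM v => (hM fun i => V (v i)).trans_eq <|
      Finset.sum_congr rfl fun i _ => Finset.sum_congr rfl fun j _ =>
        (ContinuousLinearMap.adjoint_inner_right V (v i) (M i j (V (v j)))).symm

lemma inner_krausMap (V : H →L[ℂ] K) (C : K →L[ℂ] K) (φ ψ : H) :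
    ⟪φ, krausMap V C ψ⟫_ℂ = ⟪V φ, C (V ψ)⟫_ℂ :=
  ContinuousLinearMap.adjoint_inner_right V φ (C (V ψ))

lemma cpForm_krausMap {n : Type*} [Fintype n] (V : H →L[ℂ] K) (C : n → K →L[ℂ] K) (v : n → H) :
    cpForm (krausMap V) C v = ⟪∑ i, C i (V (v i)), ∑ i, C i (V (v i))⟫_ℂ := by
  rw [← sum_inner_star_mul C fun i => V (v i), cpForm]
  simp_rw [inner_krausMap]

/-- A completely positive map in Kraus form is normal. -/
theorem isNormalMap_of_kraus {V : ι → H →L[ℂ] K} {Φ : (K →L[ℂ] K) →CP (H →L[ℂ] H)}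
    (h : ∀ C, WeakHasSum (fun i => krausMap (V i) C) (Φ C)) : IsNormalMap Φ := by
  refine IsNormalMap.of_bddBelow fun d b a c hb hle hd ha hc => le_iff_inner_le_inner.2 fun φ => ?_
  have : Nonempty d := ⟨⟨b, hb⟩⟩
  have : IsDirectedOrder d := ⟨fun s t => by
    obtain ⟨r, hr, h1, h2⟩ := hd s.1 s.2 t.1 t.2
    exact ⟨⟨r, hr⟩, h1, h2⟩⟩
  -- Subtracting `b` makes the terms nonnegative, so finite partial sums, whose limit along `d` is
  -- available, are bounded by the full sum.
  have hdiff : ∀ t, HasSum (fun i => ⟪V i φ, (t - b) (V i φ)⟫_ℂ) (⟪φ, Φ t φ⟫_ℂ - ⟪φ, Φ b φ⟫_ℂ) :=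
    fun t => by
      simpa [inner_krausMap, inner_sub_right] using (h t φ φ).sub (h b φ φ)
  have hle' : ⟪φ, Φ a φ⟫_ℂ - ⟪φ, Φ b φ⟫_ℂ ≤ ⟪φ, c φ⟫_ℂ - ⟪φ, Φ b φ⟫_ℂ := by
    refine le_of_tendsto' (hdiff a) fun F => ?_
    have ht : Tendsto (fun t : d => ∑ i ∈ F, ⟪V i φ, (t.1 - b) (V i φ)⟫_ℂ) atTop
        (𝓝 (∑ i ∈ F, ⟪V i φ, (a - b) (V i φ)⟫_ℂ)) := by
      refine tendsto_finsetSum _ fun i _ => ?_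
      simpa [inner_sub_right] using
        (tendsto_inner_of_isLUB hb hle hd ha (V i φ)).sub_const ⟪V i φ, b (V i φ)⟫_ℂ
    refine le_of_tendsto' ht fun t => ?_
    refine (sum_le_hasSum F (fun i _ => ?_) (hdiff t.1)).trans ?_
    · exact nonneg_iff_inner_nonneg.1 (sub_nonneg.2 (hle t.1 t.2)) _
    · exact sub_le_sub_right (le_iff_inner_le_inner.1 (hc t.1 t.2) φ) _
  simpa using hle'

end

/-! ### Stochastic matrices, and smearing of instruments. -/

lemma IsStochastic.le_one {M : ℕ+ → ℕ+ → ℝ} (hM : IsStochastic M) (x y : ℕ+) : M x y ≤ 1 :=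
  le_hasSum (hM.sum_eq_one y) x fun z _ => hM.nonneg z y

lemma IsStochastic.summable {M : ℕ+ → ℕ+ → ℝ} (hM : IsStochastic M) {a : ℕ+ → ℂ}
    (ha : Summable a) (x : ℕ+) : Summable fun y => (M x y : ℂ) * a y := by
  refine Summable.of_norm_bounded ha.norm fun y => ?_
  rw [norm_mul, Complex.norm_real, Real.norm_of_nonneg (hM.nonneg x y)]
  exact mul_le_of_le_one_left (norm_nonneg _) (hM.le_one x y)

/-- Fubini: unit column sums make the double series absolutely summable, with total ∑ ‖a y‖. -/
lemma IsStochastic.hasSum {M : ℕ+ → ℕ+ → ℝ} (hM : IsStochastic M) {a b : ℕ+ → ℂ} {s : ℂ}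
    (ha : HasSum a s) (hb : ∀ x, HasSum (fun y => (M x y : ℂ) * a y) (b x)) : HasSum b s := by
  have hcol : ∀ y, HasSum (fun x => (M x y : ℂ) * a y) (a y) := fun y => by
    simpa using (Complex.hasSum_ofReal.2 (hM.sum_eq_one y)).mul_right (a y)
  have hcol' : ∀ y, HasSum (fun x => ‖(M x y : ℂ) * a y‖) ‖a y‖ := fun y => by
    simpa [abs_of_nonneg (hM.nonneg _ y)] using (hM.sum_eq_one y).mul_right ‖a y‖
  have hs : Summable fun p : ℕ+ × ℕ+ => (M p.2 p.1 : ℂ) * a p.1 := by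
    refine Summable.of_norm ((summable_prod_of_nonneg fun _ => norm_nonneg _).2
      ⟨fun y => (hcol' y).summable, ?_⟩)
    simpa only [(hcol' _).tsum_eq] using ha.summable.norm
  have h1 : HasSum (fun p : ℕ+ × ℕ+ => (M p.2 p.1 : ℂ) * a p.1) s := by
    have := hs.hasSum.prod_fiberwise hcol
    rw [← this.unique ha]
    exact hs.hasSum
  exact ((Equiv.prodComm ℕ+ ℕ+).hasSum_iff.2 h1).prod_fiberwise hb

section

variable {H : Type u} [NormedAddCommGroup H] [InnerProductSpace ℂ H] [CompleteSpace H]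
  {K : Type*} [NormedAddCommGroup K] [InnerProductSpace ℂ K] [CompleteSpace K]

/-- Channels compatible with an observable are compatible with its post-processings. -/
theorem IsCompatible.of_isPostProcessing {A B : Observable H} (h : IsPostProcessing A B)
    {Λ : Channel K H} (hΛ : IsCompatible B Λ) : IsCompatible A Λ := by
  obtain ⟨M, hM, hAB⟩ := h
  obtain ⟨J, hJ, hsum⟩ := hΛ
  have hex : ∀ x, ∃ Ψ : (K →L[ℂ] K) →CP (H →L[ℂ] H),
      ∀ C, WeakHasSum (fun y => (M x y : ℂ) • J.op y C) (Ψ C) := fun x => by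
    refine exists_cp_weakHasSum (Φ := fun y => cpSMul (M x y) (hM.nonneg x y) (J.op y))
      fun C φ ψ => ?_
    simpa [cpSMul_apply, inner_smul_right] using hM.summable (hsum C φ ψ).summable x
  choose Ψ hΨ using hex
  have hΨ' : ∀ x C φ ψ, HasSum (fun y => (M x y : ℂ) * ⟪φ, J.op y C ψ⟫_ℂ) ⟪φ, Ψ x C ψ⟫_ℂ :=
    fun x C φ ψ => by simpa [inner_smul_right] using hΨ x C φ ψ
  have htot : ∀ C, WeakHasSum (fun x => Ψ x C) (Λ.toCP C) := fun C φ ψ =>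
    hM.hasSum (hsum C φ ψ) fun x => hΨ' x C φ ψ
  -- Each smeared operation is normal because it is dominated by Λ.
  refine ⟨⟨Ψ, fun x => Λ.normal.of_le fun C hC => ?_, Λ, htot⟩, fun x => ?_, htot⟩
  · exact (htot C).le (fun z => cp_nonneg (Ψ z) hC) x
  · refine (hΨ x 1).unique ?_
    simp_rw [hJ]
    exact hAB x

end

/-! ### The least disturbing channel and its decompositions. -/

section

variable {H : Type*} [NormedAddCommGroup H] [InnerProductSpace ℂ H] [CompleteSpace H]
  {K : Type*} [NormedAddCommGroup K] [InnerProductSpace ℂ K] [CompleteSpace K]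

/-- The form of a completely positive map takes the same value at two vectors whose difference
is a null vector. -/
lemma inner_eq_of_cpForm_eq_zero {Φ : (K →L[ℂ] K) →CP (H →L[ℂ] H)} {C D : K →L[ℂ] K} {φ ψ : H}
    (h : cpForm Φ ![C, D] ![φ, -ψ] = 0) :
    ⟪φ, Φ (star C * C) φ⟫_ℂ = ⟪ψ, Φ (star D * D) ψ⟫_ℂ := by
  have hpos : ∀ t s : ℝ, 0 ≤ (t : ℂ) ^ 2 * ⟪φ, Φ (star C * C) φ⟫_ℂ + t * s *
      (⟪φ, Φ (star C * C) φ⟫_ℂ + ⟪ψ, Φ (star D * D) ψ⟫_ℂ) + s ^ 2 * ⟪ψ, Φ (star D * D) ψ⟫_ℂ := by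
    intro t s
    refine (cpForm_nonneg Φ ![C, D] ![(t : ℂ) • φ, (s : ℂ) • ψ]).trans_eq ?_
    simp [cpForm] at h ⊢
    linear_combination (-t * s : ℂ) * h
  have ha := hpos 1 0
  have hd := hpos 0 1
  set a := ⟪φ, Φ (star C * C) φ⟫_ℂ
  set d := ⟪ψ, Φ (star D * D) ψ⟫_ℂ
  simp only [Complex.ofReal_one, Complex.ofReal_zero, one_pow, one_mul, mul_zero, zero_mul,
    add_zero, zero_add, ne_eq, OfNat.ofNat_ne_zero, not_false_eq_true, zero_pow] at ha hd
  lift a to ℝ using (Complex.nonneg_iff.1 ha).2.symm with a'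
  lift d to ℝ using (Complex.nonneg_iff.1 hd).2.symm with d'
  norm_cast at hpos ha hd ⊢
  -- The form t²a + ts(a + d) + s²d has discriminant (a - d)². The two test points give -a(a - d)²
  -- and -d(a - d)².
  have h1 := hpos (a' + d') (-2 * a')
  have h2 := hpos (-2 * d') (a' + d')
  have h3 : (a' + d') * (a' - d') ^ 2 ≤ 0 := by linarith
  rcases (add_nonneg ha hd).eq_or_lt with h0 | h0
  · linarith
  · have : (a' - d') ^ 2 ≤ 0 := by
      by_contra! hc
      exact absurd (mul_pos h0 hc) (not_lt.2 h3)
    exact sub_eq_zero.1 (pow_eq_zero_iff two_ne_zero |>.1 (le_antisymm this (sq_nonneg _)))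

end

section

variable {H : Type*} [NormedAddCommGroup H] [InnerProductSpace ℂ H] [CompleteSpace H]

/-- A dilation of an observable to a projection valued one, in terms of the Kraus operators of the
measurement in the dilated space. -/
structure BlockDilation (B : Observable H) (K : Type*) [NormedAddCommGroup K]
    [InnerProductSpace ℂ K] [CompleteSpace K] where
  /-- The Kraus operators. -/
  V : ℕ+ → H →L[ℂ] K
  /-- The projections to mutually orthogonal subspaces. -/
  P : ℕ+ → K →L[ℂ] K
  star_mul_self : ∀ y, star (P y) * P y = P y
  sum_le_one : ∀ F : Finset ℕ+, ∑ y ∈ F, P y ≤ 1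
  P_apply_same : ∀ y φ, P y (V y φ) = V y φ
  P_apply_of_ne : ∀ y z φ, z ≠ y → P y (V z φ) = 0
  inner_V : ∀ y φ ψ, ⟪V y φ, V y ψ⟫_ℂ = ⟪φ, B.effect y ψ⟫_ℂ

/-- The dilation on the direct sum of countably many copies of the space. -/
theorem nonempty_blockDilation (B : Observable H) :
    Nonempty (BlockDilation B (lp (fun _ : ℕ+ => H) 2)) := by
  choose b hb using fun y => CStarAlgebra.exists_eq_star_mul_self_of_nonneg (B.nonneg y)
  let ι (y : ℕ+) : H →L[ℂ] lp (fun _ : ℕ+ => H) 2 :=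
    lp.singleContinuousLinearMap ℂ (fun _ => H) 2 y
  have hι : ∀ y, (ι y).adjoint ∘L ι y = 1 := fun y => by
    ext φ
    refine ext_inner_left ℂ fun ψ => ?_
    simp [ι, ContinuousLinearMap.adjoint_inner_right, lp.inner_single_left]
  have hι' : ∀ y z, z ≠ y → (ι y).adjoint ∘L ι z = 0 := fun y z hyz => by
    ext φ
    refine ext_inner_left ℂ fun ψ => ?_
    simp [ι, ContinuousLinearMap.adjoint_inner_right, lp.inner_single_left, hyz.symm]
  let P (y : ℕ+) := ι y ∘L (ι y).adjoint
  have hPι : ∀ y φ, P y (ι y φ) = ι y φ := fun y φ => congrArg (ι y) (DFunLike.congr_fun (hι y) φ)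
  have hPι' : ∀ y z φ, z ≠ y → P y (ι z φ) = 0 := fun y z φ hyz =>
    (congrArg (ι y) (DFunLike.congr_fun (hι' y z hyz) φ)).trans (map_zero _)
  have hsa : ∀ y, star (P y) = P y := fun y => by
    simp [P, ContinuousLinearMap.star_eq_adjoint, ContinuousLinearMap.adjoint_comp]
  have hmul : ∀ y, P y * P y = P y := fun y => by
    ext1 k
    exact hPι y _
  have hmul' : ∀ y z, z ≠ y → P y * P z = 0 := fun y z hyz => by
    ext1 k
    exact hPι' y z _ hyz
  refine ⟨⟨fun y => ι y ∘L b y, P, fun y => by rw [hsa, hmul], fun F => ?_, fun y φ => hPι y _,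
    fun y z φ h => hPι' y z _ h, fun y φ ψ => ?_⟩⟩
  · have hF : IsSelfAdjoint (∑ y ∈ F, P y) := by
      simp [IsSelfAdjoint, star_sum, hsa]
    have hFF : (∑ y ∈ F, P y) * (∑ y ∈ F, P y) = ∑ y ∈ F, P y := by
      rw [Finset.sum_mul_sum]
      refine Finset.sum_congr rfl fun y hy => ?_
      rw [Finset.sum_eq_single_of_mem y hy fun z _ hz => hmul' y z hz, hmul]
    rw [← sub_nonneg]
    have := star_mul_self_nonneg (1 - ∑ y ∈ F, P y)
    rwa [star_sub, star_one, hF.star_eq, mul_sub, sub_mul, sub_mul, hFF, mul_one, mul_one, one_mul,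
      sub_self, sub_zero] at this
  · have h1 : ⟪ι y (b y φ), ι y (b y ψ)⟫_ℂ = ⟪b y φ, b y ψ⟫_ℂ := by
      simp [ι, lp.inner_single_left]
    rw [hb y]
    exact h1.trans (ContinuousLinearMap.adjoint_inner_right (b y) φ (b y ψ)).symm

namespace BlockDilation

variable {K : Type*} [NormedAddCommGroup K] [InnerProductSpace ℂ K] [CompleteSpace K]
  {B : Observable H} (D : BlockDilation B K)
include D

lemma hasSum_inner_V (φ ψ : H) : HasSum (fun y => ⟪D.V y φ, D.V y ψ⟫_ℂ) ⟪φ, ψ⟫_ℂ := by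
  simpa [D.inner_V] using B.sum_eq_one φ ψ

lemma summable_inner (C : K →L[ℂ] K) (φ ψ : H) :
    Summable fun y => ⟪φ, krausMap (D.V y) C ψ⟫_ℂ := by
  have hn : ∀ φ, Summable fun y => ‖D.V y φ‖ ^ 2 := fun φ => by
    have := (Complex.hasSum_re (D.hasSum_inner_V φ φ)).summable
    simpa [inner_self_eq_norm_sq_to_K, ← Complex.ofReal_pow] using this
  refine Summable.of_norm_bounded (((hn φ).add (hn ψ)).mul_left ‖C‖) fun y => ?_
  rw [inner_krausMap]
  calc ‖⟪D.V y φ, C (D.V y ψ)⟫_ℂ‖ ≤ ‖D.V y φ‖ * (‖C‖ * ‖D.V y ψ‖) :=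
        (norm_inner_le_norm _ _).trans (by gcongr; exact C.le_opNorm _)
    _ = ‖C‖ * (‖D.V y φ‖ * ‖D.V y ψ‖) := by ring
    _ ≤ ‖C‖ * (‖D.V y φ‖ ^ 2 + ‖D.V y ψ‖ ^ 2) := by
        gcongr
        nlinarith [sq_nonneg (‖D.V y φ‖ - ‖D.V y ψ‖), sq_nonneg ‖D.V y φ‖, sq_nonneg ‖D.V y ψ‖]

/-- The least disturbing channel of an observable. -/
theorem exists_channel :
    ∃ Λ : Channel K H, ∀ C, WeakHasSum (fun y => krausMap (D.V y) C) (Λ.toCP C) := by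
  obtain ⟨Φ, hΦ⟩ := exists_cp_weakHasSum (Φ := fun y => krausMap (D.V y)) D.summable_inner
  refine ⟨⟨Φ, isNormalMap_of_kraus hΦ, (hΦ 1).unique fun φ ψ => ?_⟩, hΦ⟩
  simpa [inner_krausMap] using D.hasSum_inner_V φ ψ

variable {Λ : Channel K H} (hΛ : ∀ C, WeakHasSum (fun y => krausMap (D.V y) C) (Λ.toCP C))
include hΛ

theorem isCompatible : IsCompatible B Λ := by
  refine ⟨⟨fun y => krausMap (D.V y), fun y => Λ.normal.of_le fun C hC => ?_, Λ, hΛ⟩,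
    fun y => ?_, hΛ⟩
  · exact (hΛ C).le (fun z => cp_nonneg _ hC) y
  · ext ψ
    refine ext_inner_left ℂ fun φ => ?_
    rw [inner_krausMap, ← D.inner_V]
    rfl

lemma inner_channel_P (y : ℕ+) (φ : H) :
    ⟪φ, Λ.toCP (D.P y) φ⟫_ℂ = ⟪D.V y φ, D.V y φ⟫_ℂ := by
  refine (hΛ (D.P y) φ φ).unique ?_
  convert hasSum_ite_eq y ⟪D.V y φ, D.V y φ⟫_ℂ using 2 with z
  rw [inner_krausMap]
  split_ifs with h
  · rw [h, D.P_apply_same]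
  · rw [D.P_apply_of_ne y z φ h, inner_zero_right]

variable {I : ℕ+ → (K →L[ℂ] K) →CP (H →L[ℂ] H)} (hI : ∀ C, WeakHasSum (fun x => I x C) (Λ.toCP C))
include hI

/-- On a block of the dilation, each part of the least disturbing channel is proportional to it. -/
lemma exists_weights (y : ℕ+) : ∃ m : ℕ+ → ℝ, (∀ x, 0 ≤ m x) ∧ HasSum m 1 ∧
    ∀ x φ, ⟪φ, I x (D.P y) φ⟫_ℂ = m x * ⟪φ, B.effect y φ⟫_ℂ := by
  have hP : 0 ≤ D.P y := by
    rw [← D.star_mul_self]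
    exact star_mul_self_nonneg _
  by_cases hV : ∀ φ, D.V y φ = 0
  · refine ⟨Pi.single 1 1, fun x => ?_, hasSum_pi_single 1 1, fun x φ => ?_⟩
    · exact (Pi.single_nonneg.2 zero_le_one : (0 : ℕ+ → ℝ) ≤ Pi.single 1 1) x
    · rw [← D.inner_V, hV, inner_zero_left, mul_zero]
      refine le_antisymm ?_ (nonneg_iff_inner_nonneg.1 (cp_nonneg (I x) hP) φ)
      refine (le_iff_inner_le_inner.1 ((hI (D.P y)).le (fun z => cp_nonneg (I z) hP) x) φ).trans ?_
      rw [D.inner_channel_P hΛ, hV, inner_zero_left]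
  push Not at hV
  obtain ⟨ψ, hψ⟩ := hV
  have hN : ⟪D.V y ψ, D.V y ψ⟫_ℂ ≠ 0 := inner_self_ne_zero.2 hψ
  set b : K := (⟪D.V y ψ, D.V y ψ⟫_ℂ)⁻¹ • D.V y ψ with hb
  have hbψ : ⟪b, D.V y ψ⟫_ℂ = 1 := by
    rw [hb, inner_smul_left, map_inv₀, inner_conj_symm, inv_mul_cancel₀ hN]
  have hbz : ∀ z, z ≠ y → ⟪b, D.V z ψ⟫_ℂ = 0 := fun z hz => by
    have h1 : ⟪D.V y ψ, D.V z ψ⟫_ℂ = 0 := by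
      rw [← D.P_apply_same y ψ, ← D.star_mul_self, mul_apply_eq_comp, D.P_apply_same]
      rw [ContinuousLinearMap.star_eq_adjoint, ContinuousLinearMap.adjoint_inner_left,
        D.P_apply_of_ne y z ψ hz, inner_zero_right]
    rw [hb, inner_smul_left, h1, mul_zero]
  have hE : 0 ≤ InnerProductSpace.rankOne ℂ b b :=
    (ContinuousLinearMap.nonneg_iff_isPositive _).2 (InnerProductSpace.isPositive_rankOne_self b)
  set c : ℕ+ → ℂ := fun x => ⟪ψ, I x (InnerProductSpace.rankOne ℂ b b) ψ⟫_ℂ with hc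
  have hc0 : ∀ x, 0 ≤ c x := fun x => nonneg_iff_inner_nonneg.1 (cp_nonneg (I x) hE) ψ
  have hcre : ∀ x, ((c x).re : ℂ) = c x := fun x =>
    Complex.ext rfl (Complex.nonneg_iff.1 (hc0 x)).2
  have key : ∀ x φ, ⟪φ, I x (D.P y) φ⟫_ℂ = c x * ⟪φ, B.effect y φ⟫_ℂ := by
    intro x φ
    -- The normalization of `b` gives `R (V y ψ) = V y φ`. Hence `P y (V z φ) = R (V z ψ)` for all
    -- z, and every Kraus term of the form vanishes.
    set R := InnerProductSpace.rankOne ℂ (D.V y φ) b with hR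
    have hzero : cpForm Λ.toCP ![D.P y, R] ![φ, -ψ] = 0 := by
      refine (hasSum_cpForm hΛ _ _).unique ?_
      convert hasSum_zero using 2 with z
      rw [cpForm_krausMap, inner_self_eq_zero, Fin.sum_univ_two]
      by_cases hz : z = y
      · subst hz
        simp [hR, D.P_apply_same, hbψ]
      · simp [hR, D.P_apply_of_ne y z φ hz, hbz z hz]
    have hzero' : cpForm (I x) ![D.P y, R] ![φ, -ψ] = 0 := by
      refine le_antisymm ?_ (cpForm_nonneg _ _ _)
      rw [← hzero]
      exact le_hasSum (hasSum_cpForm hI _ _) x fun z _ => cpForm_nonneg _ _ _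
    have h1 := inner_eq_of_cpForm_eq_zero hzero'
    -- Here φ enters only through the scalar ⟪φ, B(y) φ⟫; what remains is `c x`, which does not
    -- depend on φ.
    have h2 : star R * R = ⟪D.V y φ, D.V y φ⟫_ℂ • InnerProductSpace.rankOne ℂ b b := by
      ext1 k
      refine ext_inner_left ℂ fun l => ?_
      rw [mul_apply_eq_comp, ContinuousLinearMap.star_eq_adjoint,
        ContinuousLinearMap.adjoint_inner_right]
      simp [hR, inner_smul_left, inner_smul_right]
      ring
    rw [D.star_mul_self, h2, map_smul] at h1
    rw [h1, smul_apply, inner_smul_right, D.inner_V, mul_comm]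
  refine ⟨fun x => (c x).re, fun x => (Complex.nonneg_iff.1 (hc0 x)).1, ?_, fun x φ => ?_⟩
  · have h1 := hI (D.P y) ψ ψ
    simp_rw [key] at h1
    rw [D.inner_channel_P hΛ, ← D.inner_V] at h1
    have h2 := h1.mul_right (⟪D.V y ψ, D.V y ψ⟫_ℂ)⁻¹
    simp_rw [mul_inv_cancel_right₀ hN, mul_inv_cancel₀ hN] at h2
    exact Complex.hasSum_re h2
  · rw [hcre, key]

/-- Observables compatible with the least disturbing channel are post-processings. -/
theorem isPostProcessing {A : Observable H} (hA : ∀ x, I x 1 = A.effect x) :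
    IsPostProcessing A B := by
  choose m hm0 hm1 hm using D.exists_weights hΛ hI
  have hM : IsStochastic fun x y => m y x := ⟨fun x y => hm0 y x, hm1⟩
  refine ⟨fun x y => m y x, hM, fun x => weakHasSum_of_inner_self fun φ => ?_⟩
  have hB : HasSum (fun y => ⟪φ, B.effect y φ⟫_ℂ) ⟪φ, φ⟫_ℂ := B.sum_eq_one φ φ
  have hs := fun x => (hM.summable hB.summable x).hasSum
  have htot := (A.sum_eq_one φ φ).sub (hM.hasSum hB hs)
  -- Finite sums of the P_y lie below 1, which gives one inequality for each x. Both sides have the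
  -- same total over x, so all are equalities.
  have hle : ∀ x, ∑' y, (m y x : ℂ) * ⟪φ, B.effect y φ⟫_ℂ ≤ ⟪φ, A.effect x φ⟫_ℂ := fun x => by
    refine le_of_tendsto' (hs x) fun F => ?_
    simp_rw [← hm, ← hA, ← inner_sum, ← sum_apply, ← map_sum]
    exact le_iff_inner_le_inner.1 (OrderHomClass.mono (I x) (D.sum_le_one F)) φ
  have heq : ⟪φ, A.effect x φ⟫_ℂ ≤ ∑' y, (m y x : ℂ) * ⟪φ, B.effect y φ⟫_ℂ := by
    have := le_hasSum htot x fun z _ => sub_nonneg.2 (hle z)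
    simpa using this
  rw [heq.antisymm (hle x)]
  simpa [inner_smul_right] using hs x

end BlockDilation

end

end NoiseDisturbance

theorem theorem2 {H : Type u} [NormedAddCommGroup H] [InnerProductSpace ℂ H] [CompleteSpace H]
    [TopologicalSpace.SeparableSpace H] (A B : NoiseDisturbance.Observable H) :
    (NoiseDisturbance.IsPostProcessing A B ↔
        NoiseDisturbance.channelsOf B ⊆ NoiseDisturbance.channelsOf A) ∧
      (NoiseDisturbance.channelsOf A = NoiseDisturbance.channelsOf B →
        NoiseDisturbance.PostProcessingEquiv A B) := by
  have key : ∀ A B : NoiseDisturbance.Observable H, NoiseDisturbance.channelsOf B ⊆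
      NoiseDisturbance.channelsOf A → NoiseDisturbance.IsPostProcessing A B := by
    intro A B h
    obtain ⟨D⟩ := NoiseDisturbance.nonempty_blockDilation B
    obtain ⟨Λ, hΛ⟩ := D.exists_channel
    obtain ⟨J, hJ, hsum⟩ := @h ⟨_, Λ⟩ (D.isCompatible hΛ)
    exact D.isPostProcessing hΛ hsum hJ
  exact ⟨⟨fun h Λ hΛ => NoiseDisturbance.IsCompatible.of_isPostProcessing h hΛ, key A B⟩,
    fun h => ⟨key A B h.ge, key B A h.le⟩⟩
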